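/- A hypergraph $H$ has a vertex set $V(H)$ and a set $E(H)$ of hyperedges, which are subsets of $V(H)$; it is 3-uniform if every hyperedge has exactly three vertices. A linear cycle of length $k\ge 3$ in $H$ is an alternating sequence $v_1,h_1,v_2,h_2,\dots,v_k,h_k$ of distinct vertices and distinct hyperedges of $H$ such that $h_i\cap h_{i+1}=\{v_{i+1}\}$ for $1\le i\le k-1$, $h_1\cap h_k=\{v_1\}$, and $h_i\cap h_j=\emptyset$ whenever $1<|j-i|<k-1$. $H$ is linear-cycle-free if it contains no linear cycle. $K_m^3$ denotes the complete 3-uniform hypergraph on $m$ vertices. A set $I\subseteq V(H)$ is independent if no hyperedge of $H$ is contained in $I$, and $\alpha(H)$ is the largest size of an independent set. (1) If $H$ is a 3-uniform linear-cycle-free hypergraph on $n$ vertices ($n$ finite) that does not contain $K_5^3$ as a (not necessarily induced) subhypergraph, then $\alpha(H)\ge\lceil n/2\rceil$. (2) The bound is sharp for every $n\ge 3$. Let $H_3$ be the hypergraph on $\{v_1,v_2,v_3\}$ with the single hyperedge $v_1v_2v_3$, let $H_4$ be $K_4^3$ on $\{v_1,v_2,v_3,v_4\}$, and for $i\ge 3$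 let $V(H_{i+2})=V(H_i)\cup\{v_{i+1},v_{i+2}\}$ and $E(H_{i+2})=E(H_i)\cup\{v_{i+1}v_{i+2}v_j : 1\le j\le i\}$. Then for every $n\ge 3$ the hypergraph $H_n$ has $n$ vertices, is 3-uniform and linear-cycle-free, does not contain $K_5^3$ as a subhypergraph, and satisfies $\alpha(H_n)=\lceil n/2\rceil$. -/

import Mathlib

open scoped Hypergraph

namespace Hypergraph

/-- Every hyperedge has exactly `r` vertices (for `r ≥ 1`, `ncard = r` forces finiteness). -/
def IsUniform {α : Type*} (H : Hypergraph α) (r : ℕ) : Prop :=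
  ∀ e ∈ E(H), e.ncard = r

/-- `v 0, h 0, v 1, h 1, …, v (k-1), h (k-1)` is a linear cycle of length `k ≥ 3` in `H`:
the vertices are distinct, the hyperedges are distinct, cyclically consecutive hyperedges meet
exactly in the vertex written between them, and all other pairs of hyperedges are disjoint. -/
structure IsLinearCycle {α : Type*} (H : Hypergraph α) (k : ℕ)
    (v : Fin k → α) (h : Fin k → Set α) : Prop where
  three_le : 3 ≤ k
  vertex_mem : ∀ i, v i ∈ V(H)
  edge_mem : ∀ i, h i ∈ E(H)
  vertex_injective : Function.Injective v
  edge_injective : Function.Injective h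
  inter_succ : ∀ i j : Fin k, (j : ℕ) = (i : ℕ) + 1 → h i ∩ h j = {v j}
  inter_first_last : ∀ i j : Fin k, (i : ℕ) = 0 → (j : ℕ) + 1 = k → h i ∩ h j = {v i}
  disjoint : ∀ i j : Fin k, 1 < |((j : ℕ) : ℤ) - ((i : ℕ) : ℤ)| →
    |((j : ℕ) : ℤ) - ((i : ℕ) : ℤ)| < (k : ℤ) - 1 → h i ∩ h j = ∅

/-- `H` contains no linear cycle (of any length `k ≥ 3`). -/
def LinearCycleFree {α : Type*} (H : Hypergraph α) : Prop :=
  ¬ ∃ (k : ℕ) (v : Fin k → α) (h : Fin k → Set α), H.IsLinearCycle k v h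

/-- The complete `r`-uniform hypergraph with vertex set `S`. -/
def completeUniformOn {α : Type*} (r : ℕ) (S : Set α) : Hypergraph α where
  vertexSet := S
  edgeSet := {e | e ⊆ S ∧ e.ncard = r}
  subset_vertexSet_of_mem_edgeSet' := fun _ he => he.1

/-- `H'` is a (not necessarily induced) subhypergraph of `H`. -/
def IsSubhypergraph {α : Type*} (H' H : Hypergraph α) : Prop :=
  V(H') ⊆ V(H) ∧ E(H') ⊆ E(H)

/-- `H` contains a copy of the complete 3-uniform hypergraph on five vertices. -/
def ContainsK53 {α : Type*} (H : Hypergraph α) : Prop :=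
  ∃ S : Set α, S.ncard = 5 ∧ (completeUniformOn 3 S).IsSubhypergraph H

/-- A set of vertices of `H` that contains no hyperedge of `H`. -/
def IsIndependent {α : Type*} (H : Hypergraph α) (I : Set α) : Prop :=
  I ⊆ V(H) ∧ ∀ e ∈ E(H), ¬ e ⊆ I

/-- The largest size of an independent set (used for finite vertex sets). -/
noncomputable def indepNum {α : Type*} (H : Hypergraph α) : ℕ :=
  sSup {m : ℕ | ∃ I : Set α, H.IsIndependent I ∧ I.ncard = m}

/-- Add the vertices `a` and `b` to `H`, together with all hyperedges `{a, b, w}`, where `w` runs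
over the vertices of `H`. -/
def addPair {α : Type*} (H : Hypergraph α) (a b : α) : Hypergraph α where
  vertexSet := V(H) ∪ {a, b}
  edgeSet := E(H) ∪ {e | ∃ w ∈ V(H), e = {a, b, w}}
  subset_vertexSet_of_mem_edgeSet' := by
    rintro e (he | ⟨w, hw, rfl⟩)
    · exact (H.subset_vertexSet_of_mem_edgeSet he).trans Set.subset_union_left
    · rintro x (rfl | rfl | rfl)
      · exact Or.inr (Or.inl rfl)
      · exact Or.inr (Or.inr rfl)
      · exact Or.inl hw

/-- The hypergraph `H_n`, with `v_i` represented by the number `i`. It starts from the single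
hyperedge `{1, 2, 3}` for odd `n` and from the complete 3-uniform hypergraph on `{1, 2, 3, 4}` for
even `n`. The construction is only meant for `n ≥ 3`; the values below 3 are placeholders. -/
def iteratedPair : ℕ → Hypergraph ℕ
  | 0 => trivialOn ∅
  | 1 => trivialOn {1}
  | 2 => trivialOn {1, 2}
  | 3 => completeUniformOn 3 {1, 2, 3}
  | 4 => completeUniformOn 3 {1, 2, 3, 4}
  | (i + 3) + 2 => (iteratedPair (i + 3)).addPair ((i + 3) + 1) ((i + 3) + 2)

end Hypergraph

/-! The lower bound follows from a stronger fact: such a hypergraph is 2-colorable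
(`LinearCycleFree.twoColorable`), and the larger color class is independent. Otherwise take a family
of hyperedges that is minimal among those that are not 2-colorable. Flipping one color shows that
every triple can be extended at each of its vertices by a triple meeting it in that vertex only
(`exists_extension_of_critical`). It remains to find a K5 in any nonempty finite linear-cycle-free
system that is extendable in this sense away from a root `r` (`containsK5_of_isExtendableOffRoot`);
allowing the exceptional root is what makes induction on the number of vertices possible.

Freeness is used in the form `mem_of_path`: a triple through both ends of a path with at least two
triples has its third vertex on the path. Prolonging a path away from `r` must stop in a finite
system, and then it yields a pseudo-cycle with a tail to `r`. Choose the tail as short as possible,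
attached at `y`. Let `v ≠ y` be a vertex of the pair of a pseudo-cycle on the same vertex set. If
some triple leaves the configuration at `v`, the triples reachable from `v` outside the
configuration form a smaller system with root `v`, and induction applies. Otherwise the extension at
`v` closes a linear cycle, gives a shorter tail, or produces the triple that rotates the
pseudo-cycle. If rotation is always possible, a pseudo-cycle on five vertices spans a K5, and a
longer one contains a linear cycle (`IsPseudoCycle.containsK5`).

For sharpness, each pair of new vertices raises the independence number by at most one, because
hyperedges contain both new vertices or neither. -/

namespace TripleSystem

/-! ### Linear paths in a ternary relation -/

variable {α : Type*} [DecidableEq α]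

/-- `LPath T x y S n`: the relation `T` contains a linear path with `n` triples from `x` to `y`
whose vertex set is `S`. -/
inductive LPath (T : α → α → α → Prop) : α → α → Finset α → ℕ → Prop
  | nil (x : α) : LPath T x x {x} 0
  | cons {x u z y : α} {S S' : Finset α} {n : ℕ} : T x u z → x ≠ u → x ∉ S → u ∉ S →
      LPath T z y S n → S' = insert x (insert u S) → LPath T x y S' (n + 1)

/-- A symmetric, irreflexive ternary relation without linear cycles. -/
structure IsLinearCycleFree (T : α → α → α → Prop) : Prop where
  swap : ∀ {a b c}, T a b c → T b a c
  rot : ∀ {a b c}, T a b c → T b c a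
  ne : ∀ {a b c}, T a b c → a ≠ b
  mem_of_path : ∀ {x y z S n}, LPath T x y S n → 2 ≤ n → T x y z → z ∈ S

/-- The relation `T` contains all triples of some set with five elements. -/
def ContainsK5 (T : α → α → α → Prop) : Prop :=
  ∃ Q : Finset α, Q.card = 5 ∧ ∀ a ∈ Q, ∀ b ∈ Q, ∀ c ∈ Q, a ≠ b → a ≠ c → b ≠ c → T a b c

/-- A pair `{x, y}` together with a nontrivial linear path whose two ends both form a triple with
the pair, and a linear path with `m` triples from `y` to `r` that is otherwise disjoint. -/
def HasRootedPseudoCycle (T : α → α → α → Prop) (r : α) (m : ℕ) : Prop :=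
  ∃ x y A B S n P, LPath T A B S n ∧ 1 ≤ n ∧ T x y A ∧ T x y B ∧ x ∉ S ∧ y ∉ S ∧
    LPath T y r P m ∧ x ∉ P ∧ ∀ z ∈ P, z ∉ S

namespace LPath

variable {T : α → α → α → Prop} {x y z u w : α} {S S' : Finset α} {n n' : ℕ}

lemma left_mem (h : LPath T x y S n) : x ∈ S := by
  cases h <;> simp_all

lemma right_mem (h : LPath T x y S n) : y ∈ S := by
  induction h <;> simp_all

lemma card_eq (h : LPath T x y S n) : S.card = 2 * n + 1 := by
  induction h with
  | nil => simp
  | cons hT hne hx hu _ hS ih =>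
    subst hS
    rw [Finset.card_insert_of_notMem (by grind), Finset.card_insert_of_notMem hu, ih]
    ring

lemma eq_of_length_zero (h : LPath T x y S 0) : x = y ∧ S = {x} := by
  cases h; simp

lemma append (h : LPath T x y S n) (h' : LPath T y z S' n') (hd : ∀ v ∈ S, v ∈ S' → v = y) :
    LPath T x z (S ∪ S') (n + n') := by
  induction h with
  | nil x =>
    have := h'.left_mem
    rw [Finset.union_eq_right.mpr (by simpa using this)]
    simpa using h'
  | @cons x u c y S S₀ n hT hne hx hu hp hS ih =>
    subst hS
    have hyS := hp.right_mem
    have := ih h' (by grind)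
    rw [show n + 1 + n' = n + n' + 1 by ring]
    refine cons hT hne ?_ ?_ this (by grind)
    · grind
    · grind

variable (H : IsLinearCycleFree T)

include H in
lemma single (h : T x u z) : LPath T x z {x, u, z} 1 :=
  cons h (H.ne h) (by simpa using (H.ne (H.rot (H.rot h))).symm)
    (by simpa using H.ne (H.rot h)) (nil z) rfl

include H in
lemma snoc (h : LPath T x y S n) (hT : T y u z) (hu : u ∉ S) (hz : z ∉ S) :
    LPath T x z (insert u (insert z S)) (n + 1) := by
  have h1 := h.append (single H hT) (by grind)
  have : insert u (insert z S) = S ∪ {y, u, z} := by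
    have := h.right_mem
    grind
  rwa [this]

include H in
lemma reverse (h : LPath T x y S n) : LPath T y x S n := by
  induction h with
  | nil x => exact nil x
  | @cons x u c y S S₀ n hT hne hx hu hp hS ih =>
    have := snoc H ih (H.swap (H.rot hT)) hu hx
    rw [hS, Finset.insert_comm]
    exact this

include H in
/-- A path that reaches a pair `{s, t}` either has an initial part that meets the pair in its end
only, or passes from `c` through the triple `{c, s, t}`. -/
lemma first_hit (h : LPath T x y S n) {s t : α} (hst : s ≠ t) (hs : x ≠ s) (ht : x ≠ t)
    (hm : s ∈ S ∨ t ∈ S) :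
    (∃ s' t' S' n', (s' = s ∧ t' = t ∨ s' = t ∧ t' = s) ∧ LPath T x s' S' n' ∧ 1 ≤ n' ∧
      S' ⊆ S ∧ t' ∉ S') ∨
    (∃ s' t' c S₁ n₁ S₂ n₂, (s' = s ∧ t' = t ∨ s' = t ∧ t' = s) ∧ LPath T x c S₁ n₁ ∧
      T c s' t' ∧ LPath T s' y S₂ n₂ ∧ S₁ ⊆ S ∧ S₂ ⊆ S ∧ s' ∉ S₁ ∧ t' ∉ S₁ ∧ t' ∉ S₂ ∧
      t' ∈ S ∧ (∀ v ∈ S₁, v ∉ S₂) ∧ n₂ < n) := by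
  induction h with
  | nil x => grind
  | @cons x u c y S S₀ n hT hne hx hu hp hS ih =>
    subst hS
    have hc := hp.left_mem
    by_cases hct : c = s ∨ c = t
    · by_cases hut : u = s ∨ u = t
      · right
        -- Both remaining vertices of the first triple form the pair, so the path crosses it at
        -- once, with `x` in the role of `c`.
        have : u ≠ c := by grind
        refine ⟨c, u, x, {x}, 0, S, n, by grind, nil x, H.rot (H.rot (H.swap (H.rot hT))), hp,
          by grind, by grind, by grind, by grind, hu, by grind, by grind, by omega⟩
      · left
        obtain ⟨t', ht'⟩ : ∃ t', (c = s ∧ t' = t ∨ c = t ∧ t' = s) := by grind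
        exact ⟨c, t', {x, u, c}, 1, ht', single H hT, le_rfl, by grind, by grind⟩
    · by_cases hut : u = s ∨ u = t
      · left
        obtain ⟨t', ht'⟩ : ∃ t', (u = s ∧ t' = t ∨ u = t ∧ t' = s) := by grind
        exact ⟨u, t', {x, c, u}, 1, ht', single H (H.swap (H.rot (H.rot hT))), le_rfl, by grind,
          by grind⟩
      · rcases ih (by grind) (by grind) (by grind) with
          ⟨s', t', S', n', h1, h2, h3, h4, h5⟩ |
          ⟨s', t', c', S₁, n₁, S₂, n₂, h1, h2, h3, h4, h5, h6, h7, h8, h9, h10, h11, h12⟩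
        · left
          exact ⟨s', t', _, _, h1, cons hT hne (by grind) (by grind) h2 rfl, by omega, by grind,
            by grind⟩
        · right
          exact ⟨s', t', c', _, _, S₂, n₂, h1, cons hT hne (by grind) (by grind) h2 rfl, h3, h4,
            by grind, by grind, by grind, by grind, by grind, by grind, by grind, by omega⟩

include H in
/-- Any vertex of a path is reached by a path inside it. -/
lemma exists_to_mem (h : LPath T x y S n) (hw : w ∈ S) : ∃ S' n', LPath T x w S' n' ∧ S' ⊆ S := by
  induction h with
  | nil x => exact ⟨{x}, 0, by rw [Finset.mem_singleton] at hw; rw [hw]; exact nil x, by simp⟩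
  | @cons x u c y S S₀ n hT hne hx hu hp hS ih =>
    subst hS
    have hc := hp.left_mem
    by_cases h1 : w = x
    · subst h1
      exact ⟨{w}, 0, nil w, by grind⟩
    by_cases h2 : w = u
    · subst h2
      exact ⟨_, _, single H (H.swap (H.rot (H.rot hT))), by grind⟩
    obtain ⟨S', n', h3, h4⟩ := ih (by grind)
    exact ⟨_, _, cons hT hne (by grind) (by grind) h3 rfl, by grind⟩

end LPath

end TripleSystem

/-! ### Pseudo-cycles with a tail to the root -/

namespace TripleSystem

variable {α : Type*} [DecidableEq α]

/-- Every triple `{a, b, c}` and every vertex `a ≠ r` of it admit a triple that meets `{a, b, c}`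
exactly in `a`. -/
def IsExtendableOffRoot (T : α → α → α → Prop) (r : α) : Prop :=
  ∀ a b c, T a b c → a ≠ r → ∃ s t, T a s t ∧ s ≠ b ∧ s ≠ c ∧ t ≠ b ∧ t ≠ c

/-- Inside `U` there is a linear path with at least `k` triples from `x` to one vertex of the pair
`{s, t}` avoiding the other one. -/
def ReachesOneOf (T : α → α → α → Prop) (U : Finset α) (x : α) (k : ℕ) (s t : α) : Prop :=
  ∃ s' t' S n, (s' = s ∧ t' = t ∨ s' = t ∧ t' = s) ∧ LPath T x s' S n ∧ k ≤ n ∧ S ⊆ U ∧ t' ∉ S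

/-- Inside `U` there are linear paths from `x` to a vertex `c` forming a triple with `{s, t}`, and
from one vertex of `{s, t}` to `r` with fewer than `m` triples. -/
def CrossesPair (T : α → α → α → Prop) (U : Finset α) (r : α) (m : ℕ) (x : α) (k : ℕ) (s t : α) :
    Prop :=
  ∃ s' t' c S₁ n₁ S₂ n₂, (s' = s ∧ t' = t ∨ s' = t ∧ t' = s) ∧ LPath T x c S₁ n₁ ∧ k ≤ n₁ ∧
    T c s' t' ∧ LPath T s' r S₂ n₂ ∧ S₁ ⊆ U ∧ S₂ ⊆ U ∧ s' ∉ S₁ ∧ t' ∉ S₁ ∧ t' ∉ S₂ ∧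
    (∀ v ∈ S₁, v ∉ S₂) ∧ n₂ < m

/-- A pair `{x, y}` and a nontrivial linear path from `A` to `B` with vertex set `S` such that both
ends of the path form a triple with the pair. -/
structure IsPseudoCycle (T : α → α → α → Prop) (x y A B : α) (S : Finset α) (n : ℕ) : Prop where
  path : LPath T A B S n
  one_le : 1 ≤ n
  left : T x y A
  right : T x y B
  fst_notMem : x ∉ S
  snd_notMem : y ∉ S

variable {T : α → α → α → Prop}

lemma LPath.mono {T' : α → α → α → Prop} (hT : ∀ a b c, T a b c → T' a b c) {x y : α}
    {S : Finset α} {n : ℕ} (h : LPath T x y S n) : LPath T' x y S n := by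
  induction h with
  | nil x => exact .nil x
  | cons h1 h2 h3 h4 _ h6 ih => exact .cons (hT _ _ _ h1) h2 h3 h4 ih h6

lemma IsLinearCycleFree.rot' (H : IsLinearCycleFree T) {a b c : α} (h : T a b c) : T c a b :=
  H.rot (H.rot h)

lemma IsLinearCycleFree.swap' (H : IsLinearCycleFree T) {a b c : α} (h : T a b c) : T a c b :=
  H.rot' (H.swap (H.rot h))

/-- The path and the triple `{x, s, t}`, whose third vertex is off the path, would form a linear
cycle. -/
lemma ReachesOneOf.absurd (H : IsLinearCycleFree T) {U : Finset α} {x s t : α}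
    (h : ReachesOneOf T U x 2 s t) (hT : T x s t) : False := by
  obtain ⟨s', t', S, n, h1, h2, h3, h4, h5⟩ := h
  rcases h1 with ⟨rfl, rfl⟩ | ⟨rfl, rfl⟩
  · exact h5 (H.mem_of_path h2 h3 hT)
  · exact h5 (H.mem_of_path h2 h3 (H.swap' hT))

/-- Both ends `x` and `c` of the first path form a triple with `{s, t}`, so this is the pair of a
new pseudo-cycle; the second path is its tail. -/
lemma CrossesPair.hasRootedPseudoCycle (H : IsLinearCycleFree T) {U : Finset α} {r x s t : α}
    {m : ℕ} (h : CrossesPair T U r m x 1 s t) (hT : T x s t) :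
    ∃ m' < m, HasRootedPseudoCycle T r m' := by
  obtain ⟨s', t', c, S₁, n₁, S₂, n₂, h1, h2, h3, h4, h5, h6, h7, h8, h9, h10, h11, h12⟩ := h
  have hT' : T t' s' x := by
    rcases h1 with ⟨rfl, rfl⟩ | ⟨rfl, rfl⟩
    · exact H.swap (H.rot hT)
    · exact H.rot hT
  exact ⟨n₂, h12, t', s', x, c, S₁, n₁, S₂, h2, h3, hT', H.swap (H.rot h4), h9, h8, h5, h10,
    fun z hz hz' => h11 z hz' hz⟩

namespace IsPseudoCycle

variable {x y A B w r s t : α} {S P : Finset α} {n m : ℕ}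

/-- Let a path `P` to `r` be attached to a pseudo-cycle, and let `{s, t}` be disjoint from its pair
and its path ends. If `{s, t}` meets the configuration, then starting from `x` one either reaches
one of `s`, `t` without using the other, or `{s, t}` lies in a triple of `P`. -/
lemma reachesOneOf_or_crossesPair (H : IsLinearCycleFree T) (hC : IsPseudoCycle T x y A B S n)
    (hw : w ∈ insert y S) (hP : LPath T w r P m)
    (hd : ∀ z ∈ P, z ∈ insert x (insert y S) → z = w) (hst : s ≠ t)
    (hs : s ∉ ({x, y, A, B} : Finset α)) (ht : t ∉ ({x, y, A, B} : Finset α))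
    (hm : s ∈ insert x (insert y S) ∪ P ∨ t ∈ insert x (insert y S) ∪ P) :
    ReachesOneOf T (insert x (insert y S) ∪ P) x 2 s t ∨
      CrossesPair T (insert x (insert y S) ∪ P) r m x 1 s t := by
  obtain ⟨hp, hn, hA, hB, hx, hy⟩ := hC
  have hxy := H.ne hA
  have hAS := hp.left_mem
  have hBS := hp.right_mem
  by_cases hin : s ∈ S ∨ t ∈ S
  · left
    rcases hp.first_hit H hst (by grind) (by grind) hin with
      ⟨s', t', S', n', h1, h2, h3, h4, h5⟩ |
      ⟨s', t', c, S₁, n₁, S₂, n₂, h1, h2, h3, h4, h5, h6, h7, h8, h9, h10, h11, h12⟩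
    · exact ⟨s', t', _, _, h1, .cons hA hxy (by grind) (by grind) h2 rfl, by omega, by grind,
        by grind⟩
    -- Coming from `A`, the path crosses the pair. Its remainder, walked backwards from `B`, reaches
    -- `s'` without `t'`; it is nontrivial since `s' ≠ B`.
    · have hn₂ : 1 ≤ n₂ := by
        by_contra h0
        obtain rfl : n₂ = 0 := by omega
        have := h4.eq_of_length_zero.1
        grind
      exact ⟨s', t', _, _, h1, .cons hB hxy (by grind) (by grind) (h4.reverse H) rfl, by omega,
        by grind, by grind⟩
  -- The pair now meets only the tail: go from `x` through the pseudo-cycle to `w`, then along `P`.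
  · obtain ⟨S', n', h1, h2, h3⟩ : ∃ S' n', LPath T x w S' n' ∧ 1 ≤ n' ∧
        S' ⊆ insert x (insert y S) := by
      by_cases hwy : w = y
      · subst hwy
        exact ⟨_, _, LPath.single H (H.swap' hA), le_rfl, by grind⟩
      · obtain ⟨S', n', h1, h2⟩ := hp.exists_to_mem H (w := w) (by grind)
        exact ⟨_, _, .cons hA hxy (by grind) (by grind) h1 rfl, by omega, by grind⟩
    rcases hP.first_hit H hst (by grind) (by grind) (by grind) with
      ⟨s', t', S'', n'', h1', h2', h3', h4', h5'⟩ |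
      ⟨s', t', c, S₁, n₁, S₂, n₂, h1', h2', h3', h4', h5', h6', h7', h8', h9', h10', h11', h12'⟩
    · left
      exact ⟨s', t', _, _, h1', h1.append h2' (by grind), by omega, by grind, by grind⟩
    · right
      refine ⟨s', t', c, _, _, S₂, n₂, h1', h1.append h2' (by grind), by omega, h3', h4',
        by grind, by grind, by grind, by grind, h9', ?_, h12'⟩
      have := h2'.left_mem
      grind

/-- With lengths lowered by one, pairs meeting `{y, A, B}` can be admitted: a single triple `{x, y,
A}` or `{x, y, B}` reaches them. The missing triple is supplied by a path that arrives at `x` from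
outside. -/
lemma reachesOneOf_one_or_crossesPair (H : IsLinearCycleFree T)
    (hC : IsPseudoCycle T x y A B S n)
    (hw : w ∈ insert y S) (hP : LPath T w r P m)
    (hd : ∀ z ∈ P, z ∈ insert x (insert y S) → z = w) (hst : s ≠ t)
    (hs : s ≠ x) (ht : t ≠ x)
    (hm : s ∈ insert x (insert y S) ∪ P ∨ t ∈ insert x (insert y S) ∪ P) :
    ReachesOneOf T (insert x (insert y S) ∪ P) x 1 s t ∨
      CrossesPair T (insert x (insert y S) ∪ P) r m x 0 s t := by
  have hAS := hC.path.left_mem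
  have hBS := hC.path.right_mem
  have hxy := H.ne hC.left
  have hAB : A ≠ B := by
    rintro rfl
    have hn := hC.one_le
    have := hC.path
    cases this with
    | nil => omega
    | cons h1 h2 h3 h4 h5 h6 => exact h3 h5.right_mem
  have hxS := hC.fst_notMem
  have hyS := hC.snd_notMem
  by_cases h1 : s ∈ ({y, A, B} : Finset α) ∨ t ∈ ({y, A, B} : Finset α)
  · left
    obtain ⟨s', t', h2, h3⟩ : ∃ s' t', (s' = s ∧ t' = t ∨ s' = t ∧ t' = s) ∧
        (s' = y ∨ s' ≠ y ∧ t' ≠ y ∧ (s' = A ∨ s' = B)) := by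
      by_cases h2 : s = y ∨ t ≠ y ∧ (s = A ∨ s = B)
      · exact ⟨s, t, by grind⟩
      · exact ⟨t, s, by grind⟩
    have hpA := LPath.single H (H.swap' hC.left)
    have hpB := LPath.single H (H.swap' hC.right)
    have hpA' := LPath.single H hC.left
    have hpB' := LPath.single H hC.right
    rcases h3 with rfl | ⟨h4, h5, rfl | rfl⟩
    · by_cases ht' : t' = A
      · exact ⟨s', t', _, _, h2, hpB, le_rfl, by grind, by grind⟩
      · exact ⟨s', t', _, _, h2, hpA, le_rfl, by grind, by grind⟩
    · exact ⟨s', t', _, _, h2, hpA', le_rfl, by grind, by grind⟩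
    · exact ⟨s', t', _, _, h2, hpB', le_rfl, by grind, by grind⟩
  · rcases hC.reachesOneOf_or_crossesPair H hw hP hd hst (by grind) (by grind) hm with
      ⟨s', t', S', n', h1, h2, h3, h4⟩ | ⟨s', t', c, S₁, n₁, S₂, n₂, h1, h2, h3, h4⟩
    · exact .inl ⟨s', t', S', n', h1, h2, by omega, h4⟩
    · exact .inr ⟨s', t', c, S₁, n₁, S₂, n₂, h1, h2, by omega, h4⟩

/-- If no triple leaves the configuration at `x`, then `x` forms a triple with two vertices of the
last triple of the path. -/
lemma triple_of_no_exit (H : IsLinearCycleFree T) {z u : α} (hr : IsExtendableOffRoot T r)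
    (hm : ∀ m' < m, ¬ HasRootedPseudoCycle T r m')
    (hA : T x y A) (hB : T x y B) (hz : LPath T z A S n) (hu : T B u z) (hBS : B ∉ S)
    (huS : u ∉ S) (hx : x ∉ insert B (insert u S)) (hy : y ∉ insert B (insert u S))
    (hw : w ∈ insert y (insert B (insert u S))) (hP : LPath T w r P m)
    (hd : ∀ v ∈ P, v ∈ insert x (insert y (insert B (insert u S))) → v = w) (hxr : x ≠ r)
    (hno : ∀ s t, T x s t → s ∈ insert x (insert y (insert B (insert u S))) ∪ P ∨
      t ∈ insert x (insert y (insert B (insert u S))) ∪ P) : T x B u := by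
  have hpath : LPath T B A (insert B (insert u S)) (n + 1) :=
    .cons hu (H.ne hu) hBS huS hz rfl
  have hC : IsPseudoCycle T x y A B (insert B (insert u S)) (n + 1) :=
    ⟨hpath.reverse H, by omega, hA, hB, hx, hy⟩
  have hAS := hz.right_mem
  obtain ⟨s, t, h1, h2, h3, h4, h5⟩ := hr x y A hA hxr
  have hsx := H.ne h1
  have htx := H.ne (H.swap' h1)
  have hst := H.ne (H.rot h1)
  -- If `t ≠ u`, then `{x, B, t}` closes a linear cycle: with the path from `x` through `y` and `A`
  -- to `t` when `t ∈ S`, and with its continuation to `B` otherwise.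
  have key : ∀ t, T x B t → t ≠ y → t ≠ A → T x B u := by
    intro t ht hty htA
    by_contra hcon
    have htu : t ≠ u := by rintro rfl; exact hcon ht
    have htB := H.ne (H.rot ht)
    by_cases htS : t ∈ S
    · obtain ⟨S', n', h6, h7⟩ := (hz.reverse H).exists_to_mem H htS
      have hn' : 1 ≤ n' := by
        by_contra h0
        obtain rfl : n' = 0 := by omega
        exact htA h6.eq_of_length_zero.1.symm
      have := H.mem_of_path (.cons hA (H.ne hA) (by grind) (by grind) h6 rfl) (by omega)
        (H.swap' ht)
      grind
    · have := H.mem_of_path (.cons hA (H.ne hA) (by grind) (by grind) (hpath.reverse H) rfl)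
        (by omega) ht
      have := H.ne (H.swap' ht)
      grind
  by_cases hBs : B = s
  · subst hBs
    exact key t h1 h4 h5
  by_cases hBt : B = t
  · subst hBt
    exact key s (H.swap' h1) h2 h3
  -- If `B` is not in the extension, it yields a linear cycle or a tail shorter than `m`.
  rcases hC.reachesOneOf_or_crossesPair H hw hP hd hst (by grind) (by grind) (hno s t h1)
    with h | h
  · exact (h.absurd H h1).elim
  · obtain ⟨m', h6, h7⟩ := h.hasRootedPseudoCycle H h1
    exact (hm m' h6 h7).elim

end IsPseudoCycle

end TripleSystem

/-! ### The subsystem of triples that escape from the configuration -/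

namespace TripleSystem

variable {α : Type*} [DecidableEq α] {T : α → α → α → Prop}

/-- The triple `{a, b, c}` is joined to `x` by a linear path that starts in `c` and meets `U` only
in `x`. -/
def IsEscapeEnd (T : α → α → α → Prop) (U : Finset α) (x a b c : α) : Prop :=
  T a b c ∧ ∃ S n, LPath T c x S n ∧ a ∉ S ∧ b ∉ S ∧ ∀ v ∈ insert a (insert b S), v ∈ U → v = x

/-- The triples that can be reached from `x` by a linear path meeting `U` only in `x`. -/
def Escape (T : α → α → α → Prop) (U : Finset α) (x a b c : α) : Prop :=
  IsEscapeEnd T U x a b c ∨ IsEscapeEnd T U x b c a ∨ IsEscapeEnd T U x c a b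

section Escape

variable {U : Finset α} {r x a b c : α} {m : ℕ}

lemma IsEscapeEnd.swap (H : IsLinearCycleFree T) (h : IsEscapeEnd T U x a b c) :
    IsEscapeEnd T U x b a c := by
  obtain ⟨h, S, n, h1, h2, h3, h4⟩ := h
  exact ⟨H.swap h, S, n, h1, h3, h2, by rwa [Finset.insert_comm]⟩

lemma Escape.triple (H : IsLinearCycleFree T) (h : Escape T U x a b c) : T a b c := by
  rcases h with h | h | h
  · exact h.1
  · exact H.rot' h.1
  · exact H.rot h.1

lemma Escape.eq_of_mem (h : Escape T U x a b c) (ha : a ∈ U) :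
    a = x := by
  rcases h with ⟨_, S, n, h1, h2, h3, h4⟩ | ⟨_, S, n, h1, h2, h3, h4⟩ | ⟨_, S, n, h1, h2, h3, h4⟩
  · exact h4 a (by simp) ha
  · exact h4 a (by simp [h1.left_mem]) ha
  · exact h4 a (by simp) ha

lemma IsLinearCycleFree.escape (H : IsLinearCycleFree T) :
    IsLinearCycleFree (Escape T U x) where
  swap h := by
    rcases h with h | h | h
    · exact .inl (h.swap H)
    · exact .inr (.inr (h.swap H))
    · exact .inr (.inl (h.swap H))
  rot h := by
    rcases h with h | h | h
    · exact .inr (.inr h)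
    · exact .inl h
    · exact .inr (.inl h)
  ne h := H.ne (h.triple H)
  mem_of_path h hn hT :=
    H.mem_of_path (h.mono fun _ _ _ h' => h'.triple H) hn (hT.triple H)

/-- An extension at `a` in the full system is again an escaping triple. If it meets the path from
`c` to `x`, either a linear cycle arises or the rest of that path is its escape route. If it meets
neither the path nor `U`, the path lengthened by `{a, b, c}` serves. -/
lemma IsEscapeEnd.exists_extension (H : IsLinearCycleFree T) (hr : IsExtendableOffRoot T r)
    (hm : ∀ m' < m, ¬ HasRootedPseudoCycle T r m') (hrU : r ∈ U)
    (hR : ∀ s t, s ≠ t → s ≠ x → t ≠ x → s ∈ U ∨ t ∈ U →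
      ReachesOneOf T U x 1 s t ∨ CrossesPair T U r m x 0 s t)
    (h : IsEscapeEnd T U x a b c) (hax : a ≠ x) :
    ∃ s t, Escape T U x a s t ∧ s ≠ b ∧ s ≠ c ∧ t ≠ b ∧ t ≠ c := by
  obtain ⟨hT, S, n, hp, haS, hbS, hU⟩ := h
  obtain ⟨s, t, hst, h1, h2, h3, h4⟩ := hr a b c hT (by grind)
  have has := H.ne hst
  have hat := H.ne (H.swap' hst)
  have hne := H.ne (H.rot hst)
  have hab := H.ne hT
  have hcS := hp.left_mem
  have hxS := hp.right_mem
  refine ⟨s, t, ?_, h1, h2, h3, h4⟩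
  have hst' : ∀ {s' t'}, (s' = s ∧ t' = t ∨ s' = t ∧ t' = s) → T a s' t' := by
    rintro s' t' (⟨rfl, rfl⟩ | ⟨rfl, rfl⟩)
    · exact hst
    · exact H.swap' hst
  by_cases hSS : s ∈ S ∨ t ∈ S
  · rcases hp.first_hit H hne (by grind) (by grind) hSS with
      ⟨s', t', S', n', h1, h2, h3, h4, h5⟩ |
      ⟨s', t', c', S₁, n₁, S₂, n₂, h1, h2, h3, h4, h5, h6, h7, h8, h9, h10, h11, h12⟩
    · have := H.mem_of_path (.cons hT hab (by grind) (by grind) h2 rfl) (by omega) (hst' h1)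
      grind
    · have hE : IsEscapeEnd T U x a t' s' :=
        ⟨H.swap' (hst' h1), S₂, n₂, h4, by grind, h9, by grind⟩
      rcases h1 with ⟨rfl, rfl⟩ | ⟨rfl, rfl⟩
      · exact H.escape.swap' (.inl hE)
      · exact .inl hE
  · by_cases hUU : s ∈ U ∨ t ∈ U
    · exfalso
      have hpa : LPath T a x (insert a (insert b S)) (n + 1) :=
        .cons hT hab haS hbS hp rfl
      rcases hR s t hne (by grind) (by grind) hUU with
        ⟨s', t', S', n', h1', h2', h3', h4', h5'⟩ |
        ⟨s', t', c', S₁, n₁, S₂, n₂, h1', h2', h3', h4', h5', h6', h7', h8', h9', h10', h11', h12'⟩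
      · have := H.mem_of_path (hpa.append h2' (by grind)) (by omega) (hst' h1')
        grind
      · have hx1 := h2'.left_mem
        exact hm n₂ h12' ⟨t', s', a, c', _, _, S₂, hpa.append h2' (by grind), by omega,
          H.swap (H.rot (hst' h1')), H.swap (H.rot h4'), by grind, by grind, h5',
          by grind, by grind⟩
    · exact .inr (.inl ⟨H.rot hst, insert a (insert b S), n + 1, .cons hT hab haS hbS hp rfl,
        by grind, by grind, by grind⟩)

/-- At the vertex where the escape path of a triple begins, the first triple of that path is the
extension; the other two vertices are covered by `IsEscapeEnd.exists_extension`. -/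
lemma IsExtendableOffRoot.escape (H : IsLinearCycleFree T) (hr : IsExtendableOffRoot T r)
    (hm : ∀ m' < m, ¬ HasRootedPseudoCycle T r m') (hrU : r ∈ U)
    (hR : ∀ s t, s ≠ t → s ≠ x → t ≠ x → s ∈ U ∨ t ∈ U →
      ReachesOneOf T U x 1 s t ∨ CrossesPair T U r m x 0 s t) :
    IsExtendableOffRoot (Escape T U x) x := by
  rintro a b c (h | h | h) hax
  · exact h.exists_extension H hr hm hrU hR hax
  · obtain ⟨_, S, n, h1, h2, h3, h4⟩ := h
    cases h1 with
    | nil => exact absurd rfl hax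
    | @cons _ u z _ S _ n h5 h6 h7 h8 h9 h10 =>
      subst h10
      have hz := h9.left_mem
      exact ⟨u, z, .inl ⟨h5, S, n, h9, h7, h8, by grind⟩, by grind, by grind, by grind, by grind⟩
  · obtain ⟨s, t, h1, h2, h3, h4, h5⟩ := (h.swap H).exists_extension H hr hm hrU hR hax
    exact ⟨s, t, h1, h3, h2, h5, h4⟩

end Escape

/-! ### Rotating pseudo-cycles -/

/-- Every pseudo-cycle with vertex set `C` can be turned by one step at a vertex `v ≠ y` of its
pair. -/
def CanRotate (T : α → α → α → Prop) (C : Finset α) (y : α) : Prop :=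
  ∀ v e A B u z S n, LPath T z A S n → T B u z → B ∉ S → u ∉ S → v ∉ insert B (insert u S) →
    e ∉ insert B (insert u S) → T v e A → T v e B →
    insert v (insert e (insert B (insert u S))) = C → v ≠ y → T v B u

/-- Of the ten triples on the five vertices three are given; rotations at vertices other than `y`
produce the other seven one after another. -/
lemma CanRotate.containsK5 (H : IsLinearCycleFree T) {x y A b B : α}
    (hN : CanRotate T {x, y, A, b, B} y) (hAbB : T A b B) (hA : T x y A) (hB : T x y B)
    (hbx : b ≠ x) (hby : b ≠ y) : ContainsK5 T := by
  have h1 := H.ne hAbB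
  have h2 := H.ne (H.rot hAbB)
  have h3 := H.ne (H.swap' hAbB)
  have h4 := H.ne hA
  have h5 := H.ne (H.rot hA)
  have h6 := H.ne (H.swap' hA)
  have h7 := H.ne (H.rot hB)
  have h8 := H.ne (H.swap' hB)
  -- One rotation of a pseudo-cycle whose path is a single triple, so that the inner path from `z`
  -- to `A` is trivial.
  have rule : ∀ A' u B' v e, T A' u B' → T v e A' → T v e B' → u ≠ v → u ≠ e →
      ({v, e, B', u, A'} : Finset α) = {x, y, A, b, B} → v ≠ y → T v B' u := by
    intro A' u B' v e k1 k2 k3 k4 k5 k6 k7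
    have l1 := H.ne k1
    have l2 := H.ne (H.rot k1)
    have l3 := H.ne (H.swap' k1)
    have l5 := H.ne (H.rot k2)
    have l6 := H.ne (H.swap' k2)
    have l7 := H.ne (H.rot k3)
    have l8 := H.ne (H.swap' k3)
    exact hN v e A' B' u A' {A'} 0 (.nil A') (H.swap (H.rot k1)) (by grind) (by grind)
      (by grind) (by grind) k2 k3 k6 k7
  have sw : ∀ a b c, T a b c → T b a c := fun _ _ _ h => H.swap h
  have ro : ∀ a b c, T a b c → T b c a := fun _ _ _ h => H.rot h
  have e1 : T x B b := by
    refine rule A b B x y ?_ ?_ ?_ (by grind) (by grind) ?_ (by grind)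
    on_goal 4 => ext; simp only [Finset.mem_insert, Finset.mem_singleton]; tauto
    all_goals grind
  have e2 : T x A b := by
    refine rule B b A x y ?_ ?_ ?_ (by grind) (by grind) ?_ (by grind)
    on_goal 4 => ext; simp only [Finset.mem_insert, Finset.mem_singleton]
    all_goals grind
  have e3 : T b x y := by
    refine rule A y x b B ?_ ?_ ?_ (by grind) (by grind) ?_ (by grind)
    on_goal 4 => ext; simp only [Finset.mem_insert, Finset.mem_singleton]; tauto
    all_goals grind
  have e4 : T b A y := by
    refine rule x y A b B ?_ ?_ ?_ (by grind) (by grind) ?_ (by grind)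
    on_goal 4 => ext; simp only [Finset.mem_insert, Finset.mem_singleton]; tauto
    all_goals grind
  have e5 : T B A y := by
    refine rule x y A B b ?_ ?_ ?_ (by grind) (by grind) ?_ (by grind)
    on_goal 4 => ext; simp only [Finset.mem_insert, Finset.mem_singleton]; tauto
    all_goals grind
  have e6 : T b B y := by
    refine rule x y B b A ?_ ?_ ?_ (by grind) (by grind) ?_ (by grind)
    on_goal 4 => ext; simp only [Finset.mem_insert, Finset.mem_singleton]; tauto
    all_goals grind
  have e7 : T x B A := by
    refine rule y A B x b ?_ ?_ ?_ (by grind) (by grind) ?_ (by grind)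
    on_goal 4 => ext; simp only [Finset.mem_insert, Finset.mem_singleton]; tauto
    all_goals grind
  refine ⟨{x, y, A, b, B}, ?_, ?_⟩
  · rw [Finset.card_insert_of_notMem, Finset.card_insert_of_notMem, Finset.card_insert_of_notMem,
      Finset.card_insert_of_notMem, Finset.card_singleton] <;>
      simp only [Finset.mem_insert, Finset.mem_singleton, not_or] <;> clear hN rule <;> grind
  · intro p hp q hq w hw hpq hpw hqw
    simp only [Finset.mem_insert, Finset.mem_singleton] at hp hq hw
    rcases hp with rfl | rfl | rfl | rfl | rfl <;> rcases hq with rfl | rfl | rfl | rfl | rfl <;>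
      first
      | exact absurd rfl hpq
      | rcases hw with rfl | rfl | rfl | rfl | rfl <;>
        first
        | exact absurd rfl hpw
        | exact absurd rfl hqw
        | clear hN rule; grind

end TripleSystem

namespace TripleSystem

variable {α : Type*} [DecidableEq α] {T : α → α → α → Prop}

/-- The pair `{e, v}` has path ends `d` and `v'`, joined through `c`, `b`, `a`, `y`, `x` on the
vertex set `C`. Each rotation at `v` pushes the pair one triple along the path towards `c` and
lengthens the path that starts in `x`. When the pair arrives at `c`, that path can be continued to
`b` while avoiding `a`, and `{x, a, b}` closes it to a linear cycle. -/
lemma CanRotate.false_of_chain (H : IsLinearCycleFree T) {C S₁ S₂ : Finset α}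
    {a b c d e v v' x y : α} {m n : ℕ} (hN : CanRotate T C y) (h₂ : LPath T d c S₂ m)
    (h₁ : LPath T x v' S₁ n) (hv' : T e v v') (hd : T e v d) (habc : T a b c) (hxya : T x y a)
    (hxab : T x a b) (hdisj : ∀ z ∈ S₁, z ∉ S₂)
    (hS : ∀ z, z = e ∨ z = v ∨ z = a ∨ z = b ∨ z = y → z ∉ S₁ ∧ z ∉ S₂)
    (hev : e ≠ a ∧ e ≠ b ∧ e ≠ y ∧ v ≠ a ∧ v ≠ b ∧ v ≠ y) (hby : b ≠ y)
    (hC : ∀ z, z ∈ C ↔ z ∈ S₁ ∨ z ∈ S₂ ∨ z = e ∨ z = v ∨ z = a ∨ z = b ∨ z = y) : False := by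
  have hab := H.ne habc
  have hya := H.ne (H.rot hxya)
  have hxS := h₁.left_mem
  induction h₂ generalizing e v v' S₁ n with
  | nil c =>
    have he' := hS e (by simp)
    have hv₀ := hS v (by simp)
    have ha' := hS a (by simp)
    have hb' := hS b (by simp)
    have hy' := hS y (by simp)
    clear hS
    simp only [Finset.mem_singleton] at *
    have hvne := H.ne hv'
    have hvS := h₁.right_mem
    have hcb := H.swap (H.rot habc)
    have hp : LPath T a v' _ _ := .cons (H.swap (H.rot hxya)) (by grind) (by grind)
      (by grind) h₁ rfl
    have hT : T v c b := hN v e v' c b a _ _ hp hcb (by grind) (by grind) (by grind) (by grind)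
      (H.swap hv') (H.swap hd) (by ext z; rw [hC]; grind) (by grind)
    have hp' := (h₁.snoc H (H.rot' hv') (by grind) (by grind)).snoc H hT (by grind) (by grind)
    have := H.mem_of_path hp' (by omega) (H.swap' hxab)
    grind
  | @cons d u z c S S' m hT hne hx hu hp hS' ih =>
    subst hS'
    have he' := hS e (by simp)
    have hv₀ := hS v (by simp)
    have ha' := hS a (by simp)
    have hb' := hS b (by simp)
    have hy' := hS y (by simp)
    clear hS
    have hvne := H.ne hv'
    have hvS := h₁.right_mem
    have hcS := hp.right_mem
    have hcb := H.swap (H.rot habc)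
    have hp' := (hp.snoc H hcb (by grind) (by grind)).append
      (.cons (H.swap (H.rot hxya)) (by grind) (by grind) (by grind) h₁ rfl) (by grind)
    -- After this rotation the pair is `{d, u}`, with path ends `v` and `z`.
    have hT' : T v d u := hN v e v' d u z _ _ hp' hT (by grind) (by grind) (by grind) (by grind)
      (H.swap hv') (H.swap hd) (by ext z; rw [hC]; grind) (by grind)
    exact ih (h₁.snoc H (H.rot' hv') (by grind) (by grind)) (H.rot hT') hT habc (by grind)
      (by grind) (by grind) (by intro z; rw [hC]; grind) (by grind)

/-- If a pseudo-cycle can be rotated at all vertices except for one vertex of its pair, then its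
vertices span a complete triple system on five vertices. -/
lemma IsPseudoCycle.containsK5 (H : IsLinearCycleFree T) {x y A B : α} {S : Finset α} {n : ℕ}
    (hC : IsPseudoCycle T x y A B S n) (hN : CanRotate T (insert x (insert y S)) y) :
    ContainsK5 T := by
  obtain ⟨hp, hn, hA, hB, hx, hy⟩ := hC
  have hxy := H.ne hA
  cases hp with
  | nil => omega
  | @cons a b c _ S S' n hT hab ha hb hp hS =>
    subst hS
    have hc := hp.left_mem
    cases hp.reverse H with
    | nil =>
      exact hN.containsK5 H hT hA hB (by grind) (by grind)
    | @cons B u z _ S' _ n hT' hBu hB' hu hp' hS' =>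
      subst hS'
      have hzS := hp'.left_mem
      have hcS := hp'.right_mem
      have h1 : T x B u := hN x y A B u z _ _
        (hp'.snoc H (H.swap (H.rot hT)) (by grind) (by grind)) hT' (by grind) (by grind)
        (by grind) (by grind) hA hB (by ext; grind) hxy
      have h2 : T x A b := hN x y B A b c _ _ hp hT (by grind) (by grind)
        (by grind) (by grind) hB hA (by ext; grind) hxy
      exact (hN.false_of_chain H hp' (.nil x) (H.rot h1) hT' hT hA h2 (by grind) (by grind)
        (by grind) (by grind) (by intro z; grind)).elim

/-! ### Existence of rooted pseudo-cycles and the induction -/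

lemma LPath.subset {W S : Finset α} {x y : α} {n : ℕ} (H : IsLinearCycleFree T)
    (hW : ∀ a b c, T a b c → a ∈ W) (h : LPath T x y S n) (hy : y ∈ W) : S ⊆ W := by
  induction h with
  | nil => simpa using hy
  | @cons x u z y S S' n hT hne hx hu hp hS ih =>
    have := hW _ _ _ hT
    have := hW _ _ _ (H.rot hT)
    grind

/-- Extend the first triple at `x`. An extension that meets the rest of the path closes a linear
cycle, or is crossed by the path and thus gives a pseudo-cycle with the remainder as tail to `r`. -/
lemma LPath.exists_longer (H : IsLinearCycleFree T) {r x : α} {S : Finset α} {n : ℕ}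
    (hr : IsExtendableOffRoot T r) (hno : ∀ m, ¬ HasRootedPseudoCycle T r m)
    (h : LPath T x r S (n + 1)) : ∃ x' S', LPath T x' r S' (n + 2) := by
  cases h with
  | @cons a b c _ S S' n hT hab ha hb hp hS =>
    have hcS := hp.left_mem
    have hrS := hp.right_mem
    obtain ⟨s, t, hst, h1, h2, h3, h4⟩ := hr x b c hT (by grind)
    have has := H.ne hst
    have hat := H.ne (H.swap' hst)
    have hne := H.ne (H.rot hst)
    by_cases hSS : s ∈ S ∨ t ∈ S
    · exfalso
      have hst' : ∀ {s' t'}, (s' = s ∧ t' = t ∨ s' = t ∧ t' = s) → T x s' t' := by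
        rintro s' t' (⟨rfl, rfl⟩ | ⟨rfl, rfl⟩)
        · exact hst
        · exact H.swap' hst
      rcases hp.first_hit H hne (by grind) (by grind) hSS with
        ⟨s', t', S', n', h1, h2, h3, h4, h5⟩ |
        ⟨s', t', c', S₁, n₁, S₂, n₂, h1, h2, h3, h4, h5, h6, h7, h8, h9, h10, h11, h12⟩
      · have := H.mem_of_path (.cons hT hab (by grind) (by grind) h2 rfl) (by omega) (hst' h1)
        grind
      · exact hno n₂ ⟨t', s', x, c', _, _, S₂, .cons hT hab (by grind) (by grind) h2 rfl,
          by omega, H.swap (H.rot (hst' h1)), H.swap (H.rot h3), by grind, by grind, h4, h9,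
          by grind⟩
    · exact ⟨s, _, .cons (H.rot hst) hne (by grind) (by grind)
        (.cons hT hab ha hb hp hS) rfl⟩

lemma exists_hasRootedPseudoCycle (H : IsLinearCycleFree T) {W : Finset α} {r b c : α}
    (hW : ∀ a b c, T a b c → a ∈ W) (hr : IsExtendableOffRoot T r) (hrbc : T r b c) :
    ∃ m, HasRootedPseudoCycle T r m := by
  by_contra! hno
  have key : ∀ n, ∃ x S, LPath T x r S (n + 1) := by
    intro n
    induction n with
    | zero => exact ⟨b, _, LPath.single H (H.rot hrbc)⟩
    | succ n ih =>
      obtain ⟨x, S, h⟩ := ih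
      exact h.exists_longer H hr hno
  -- A path with `W.card + 1` triples has more vertices than `W`.
  obtain ⟨x, S, h⟩ := key W.card
  have h1 := Finset.card_le_card (h.subset H hW (hW _ _ _ hrbc))
  have h2 := h.card_eq
  omega

/-- A nonempty finite triple system without linear cycles in which every triple can be extended
at all vertices except possibly a root contains a complete triple system on five vertices. -/
theorem containsK5_of_isExtendableOffRoot (H : IsLinearCycleFree T) {W : Finset α} {r b c : α}
    (hW : ∀ a b c, T a b c → a ∈ W) (hr : IsExtendableOffRoot T r) (hrbc : T r b c) :
    ContainsK5 T := by
  induction hk : W.card using Nat.strong_induction_on generalizing T W r b c with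
  | _ k ih =>
    subst hk
    classical
    have hex := exists_hasRootedPseudoCycle H hW hr hrbc
    have hmin : ∀ m' < Nat.find hex, ¬ HasRootedPseudoCycle T r m' := fun m' h => Nat.find_min hex h
    obtain ⟨x, y, A, B, S, n, P, hp, hn, hA, hB, hx, hy, hP, hxP, hPS⟩ := Nat.find_spec hex
    by_contra hK
    have hyP := hP.left_mem
    have hrP := hP.right_mem
    refine hK (IsPseudoCycle.containsK5 H ⟨hp, hn, hA, hB, hx, hy⟩ ?_)
    intro v e A' B' u z S' n' hz hu hB'S hu' hv he hA' hB' hC hvy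
    have hyC : y ∈ insert e (insert B' (insert u S')) := by
      have : y ∈ insert x (insert y S) := by simp
      rw [← hC] at this
      grind
    -- The rotated pseudo-cycle has the same vertex set, so the minimal tail `P` still meets it in
    -- `y` only.
    have hd : ∀ w ∈ P, w ∈ insert v (insert e (insert B' (insert u S'))) → w = y := by
      rw [hC]; grind
    have hvU : v ∈ insert v (insert e (insert B' (insert u S'))) ∪ P := by simp
    have hrU : r ∈ insert v (insert e (insert B' (insert u S'))) ∪ P := by simp [hrP]
    have hyU : y ∈ insert v (insert e (insert B' (insert u S'))) ∪ P := by simp [hyP]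
    refine IsPseudoCycle.triple_of_no_exit H hr hmin hA' hB' hz hu hB'S hu' hv he hyC hP hd
      (by rintro rfl; exact hvy (hd _ hrP (by simp))) ?_
    by_contra! hexit
    obtain ⟨s, t, hvst, hs, ht⟩ := hexit
    have hC' : IsPseudoCycle T v e A' B' (insert B' (insert u S')) (n' + 1) :=
      ⟨LPath.reverse H (.cons hu (H.ne hu) hB'S hu' hz rfl), by omega, hA', hB', hv, he⟩
    have hR := fun s t hst hsv htv hm =>
      hC'.reachesOneOf_one_or_crossesPair H (s := s) (t := t) hyC hP hd hst hsv htv hm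
    have hyW : y ∈ W := hW _ _ _ (H.swap hA)
    -- Escaping triples meet the configuration at most in `v`, hence avoid `y`: the subsystem lives
    -- on `W.erase y`. The exit `{v, s, t}` makes it nonempty.
    have hE : ContainsK5 (Escape T
        (insert v (insert e (insert B' (insert u S'))) ∪ P) v) := by
      refine ih (W.erase y).card (Finset.card_erase_lt_of_mem hyW) (b := s) (c := t) H.escape
        ?_ (hr.escape H hmin hrU hR) ?_ rfl
      · intro a b c h
        refine Finset.mem_erase.mpr ⟨?_, hW _ _ _ (h.triple H)⟩
        rintro rfl
        exact hvy (h.eq_of_mem hyU).symm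
      · have hvs := H.ne hvst
        have hvt := H.ne (H.swap' hvst)
        refine .inr (.inl ⟨H.rot hvst, {v}, 0, .nil v, by simpa using hvs.symm,
          by simpa using hvt.symm, ?_⟩)
        intro w hw hwU
        simp only [Finset.mem_insert, Finset.mem_singleton] at hw
        rcases hw with rfl | rfl | rfl
        · exact absurd hwU hs
        · exact absurd hwU ht
        · rfl
    obtain ⟨Q, hQ, hQ'⟩ := hE
    exact hK ⟨Q, hQ, fun a ha b hb c hc h1 h2 h3 => (hQ' a ha b hb c hc h1 h2 h3).triple H⟩

end TripleSystem

/-! ### From ternary relations back to hypergraphs -/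

namespace TripleSystem

variable {α : Type*}

lemma LPath.exists_enumeration [DecidableEq α] {T : α → α → α → Prop} {x y : α} {S : Finset α}
    {n : ℕ} (h : LPath T x y S n) :
    ∃ c u : ℕ → α, c 0 = x ∧ c n = y ∧ (∀ i < n, T (c i) (u i) (c (i + 1))) ∧
      (∀ i ≤ n, c i ∈ S) ∧ (∀ i < n, u i ∈ S) ∧
      (∀ i ≤ n, ∀ j ≤ n, c i = c j → i = j) ∧ (∀ i < n, ∀ j < n, u i = u j → i = j) ∧
      ∀ i ≤ n, ∀ j < n, c i ≠ u j := by
  induction h with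
  | nil x => exact ⟨fun _ => x, fun _ => x, by simp⟩
  | @cons x w z y S S' n hT hne hx hw _ hS ih =>
    obtain ⟨c, u, h1, h2, h3, h4, h5, h6, h7, h8⟩ := ih
    subst hS
    refine ⟨fun i => Nat.casesOn i x c, fun i => Nat.casesOn i w u, rfl, h2, ?_, ?_, ?_, ?_, ?_, ?_⟩
    · rintro (_ | i) hi
      · simpa [h1] using hT
      · exact h3 i (by omega)
    · rintro (_ | i) hi
      · simp
      · simp [h4 i (by omega)]
    · rintro (_ | i) hi
      · simp
      · simp [h5 i (by omega)]
    · rintro (_ | i) hi (_ | j) hj h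
      · rfl
      · exact absurd (h4 j (by omega)) (by dsimp only at h; rwa [← h])
      · exact absurd (h4 i (by omega)) (by dsimp only at h; rwa [h])
      · exact congrArg (· + 1) (h6 i (by omega) j (by omega) h)
    · rintro (_ | i) hi (_ | j) hj h
      · rfl
      · exact absurd (h5 j (by omega)) (by dsimp only at h; rwa [← h])
      · exact absurd (h5 i (by omega)) (by dsimp only at h; rwa [h])
      · exact congrArg (· + 1) (h7 i (by omega) j (by omega) h)
    · rintro (_ | i) hi (_ | j) hj h
      · exact hne h
      · exact absurd (h5 j (by omega)) (by dsimp only at h; rwa [← h])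
      · exact absurd (h4 i (by omega)) (by dsimp only at h; rwa [h])
      · exact h8 i (by omega) j (by omega) h

end TripleSystem

namespace Hypergraph

variable {α : Type*}

open TripleSystem

/-- The relation that three distinct elements form a member of the family `E`. -/
def tripleRel (E : Set (Set α)) (a b c : α) : Prop :=
  a ≠ b ∧ a ≠ c ∧ b ≠ c ∧ {a, b, c} ∈ E

/-- The `c i` are the linking vertices and each `u i` lies in one hyperedge only, so two hyperedges
can share only a vertex that ends one and begins the other. There are `n + 1 ≥ 3` hyperedges, the
last one returning to `c 0`. -/
lemma exists_isLinearCycle {H : Hypergraph α} {n : ℕ} (hn : 2 ≤ n) {c u : ℕ → α}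
    (hc : ∀ i ≤ n, ∀ j ≤ n, c i = c j → i = j) (hu : ∀ i ≤ n, ∀ j ≤ n, u i = u j → i = j)
    (hcu : ∀ i ≤ n, ∀ j ≤ n, c i ≠ u j)
    (hE : ∀ i ≤ n, ({c i, u i, c (if i = n then 0 else i + 1)} : Set α) ∈ E(H)) :
    ∃ (k : ℕ) (v : Fin k → α) (h : Fin k → Set α), H.IsLinearCycle k v h := by
  have key : ∀ i ≤ n, ∀ j ≤ n, i ≠ j → ∀ w,
      w ∈ ({c i, u i, c (if i = n then 0 else i + 1)} : Set α) ∩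
        {c j, u j, c (if j = n then 0 else j + 1)} ↔
      (w = c i ∧ i = if j = n then 0 else j + 1) ∨ (w = c j ∧ j = if i = n then 0 else i + 1) := by
    intro i hi j hj hij w
    have hsi : (if i = n then 0 else i + 1) ≤ n := by split_ifs <;> omega
    have hsj : (if j = n then 0 else j + 1) ≤ n := by split_ifs <;> omega
    have hss : (if i = n then 0 else i + 1) ≠ if j = n then 0 else j + 1 := by
      split_ifs <;> omega
    generalize (if i = n then 0 else i + 1) = si at *
    generalize (if j = n then 0 else j + 1) = sj at *
    simp only [Set.mem_inter_iff, Set.mem_insert_iff, Set.mem_singleton_iff]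
    constructor
    · rintro ⟨rfl | rfl | rfl, h | h | h⟩
      · exact absurd (hc _ hi _ hj h) hij
      · exact absurd h (hcu _ hi _ hj)
      · exact .inl ⟨rfl, hc _ hi _ hsj h⟩
      · exact absurd h.symm (hcu _ hj _ hi)
      · exact absurd (hu _ hi _ hj h) hij
      · exact absurd h.symm (hcu _ hsj _ hi)
      · exact .inr ⟨h, hc _ hj _ hsi h.symm⟩
      · exact absurd h (hcu _ hsi _ hj)
      · exact absurd (hc _ hsi _ hsj h) hss
    · rintro (⟨rfl, rfl⟩ | ⟨rfl, rfl⟩) <;> simp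
  refine ⟨n + 1, fun i => c i, fun i => {c i, u i, c (if (i : ℕ) = n then 0 else i + 1)},
    by omega, ?_, fun i => hE i (by omega), ?_, ?_, ?_, ?_, ?_⟩
  · intro i
    exact H.subset_vertexSet_of_mem_edgeSet (hE i (by omega)) (by simp)
  · intro i j h
    exact Fin.ext (hc i (by omega) j (by omega) h)
  · intro i j h
    by_contra hij
    have hij' : (i : ℕ) ≠ j := fun h => hij (Fin.ext h)
    have h1 := (key i (by omega) j (by omega) hij' (u i)).1 ⟨by simp, by
      dsimp only at h; rw [← h]; simp⟩
    rcases h1 with ⟨h1, _⟩ | ⟨h1, _⟩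
    · exact hcu i (by omega) i (by omega) h1.symm
    · exact hcu j (by omega) i (by omega) h1.symm
  · intro i j hij
    ext w
    rw [key i (by omega) j (by omega) (by omega) w, Set.mem_singleton_iff]
    have : ¬ (i : ℕ) = if (j : ℕ) = n then 0 else (j : ℕ) + 1 := by split_ifs <;> omega
    have : (j : ℕ) = if (i : ℕ) = n then 0 else (i : ℕ) + 1 := by
      rw [if_neg (by omega)]; exact hij
    tauto
  · intro i j hi hj
    ext w
    rw [key i (by omega) j (by omega) (by omega) w, Set.mem_singleton_iff]
    have : ¬ (j : ℕ) = if (i : ℕ) = n then 0 else (i : ℕ) + 1 := by split_ifs <;> omega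
    have : (i : ℕ) = if (j : ℕ) = n then 0 else (j : ℕ) + 1 := by
      rw [if_pos (by omega)]; exact hi
    tauto
  · intro i j h1 h2
    ext w
    have hij : (i : ℕ) ≠ j := by
      intro h
      simp [h] at h1
    have h3 : ¬ (j : ℕ) = if (i : ℕ) = n then 0 else (i : ℕ) + 1 := by
      split_ifs <;> grind
    have h4 : ¬ (i : ℕ) = if (j : ℕ) = n then 0 else (j : ℕ) + 1 := by
      split_ifs <;> grind
    rw [key i (by omega) j (by omega) hij w]
    simp only [Set.mem_empty_iff_false]
    tauto

lemma isLinearCycleFree_tripleRel [DecidableEq α] {H : Hypergraph α} (hH : H.LinearCycleFree)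
    {E : Set (Set α)} (hE : E ⊆ E(H)) : IsLinearCycleFree (tripleRel E) where
  swap := by
    rintro a b c ⟨h1, h2, h3, h4⟩
    exact ⟨h1.symm, h3, h2, by rwa [Set.insert_comm]⟩
  rot := by
    rintro a b c ⟨h1, h2, h3, h4⟩
    refine ⟨h3, h1.symm, h2.symm, ?_⟩
    rwa [Set.pair_comm c a, Set.insert_comm]
  ne h := h.1
  mem_of_path := by
    intro x y z S n h hn hT
    by_contra hz
    obtain ⟨c, u, h1, h2, h3, h4, h5, h6, h7, h8⟩ := h.exists_enumeration
    -- The closing triple is the hyperedge with index `n`, with private vertex `z`.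
    refine hH (exists_isLinearCycle hn (c := c) (u := fun i => if i < n then u i else z) h6 ?_ ?_ ?_)
    · intro i hi j hj h
      grind
    · intro i hi j hj h
      grind
    · intro i hi
      apply hE
      by_cases hin : i < n
      · simpa [hin, hin.ne] using (h3 i hin).2.2.2
      · obtain rfl : i = n := by omega
        simp only [lt_irrefl, if_false, if_true, h1, h2]
        have := hT.2.2.2
        rwa [Set.insert_comm, Set.pair_comm x z] at this

/-! ### 2-colorability and the lower bound -/

/-- There is a coloring of the vertices with two colors without monochromatic member of `E`. -/
def TwoColorable (E : Set (Set α)) : Prop :=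
  ∃ χ : α → Bool, ∀ e ∈ E, ∃ a ∈ e, ∃ b ∈ e, χ a ≠ χ b

/-- In a family of triples that becomes 2-colorable when any member is removed, but is not
2-colorable itself, every triple can be extended at all its vertices. -/
lemma exists_extension_of_critical {E : Set (Set α)} (hE : ∀ e ∈ E, e.ncard = 3)
    (hcol : ¬ TwoColorable E) (hcrit : ∀ e ∈ E, TwoColorable (E \ {e})) {a b c : α}
    (h : tripleRel E a b c) :
    ∃ s t, tripleRel E a s t ∧ s ≠ b ∧ s ≠ c ∧ t ≠ b ∧ t ≠ c := by
  classical
  obtain ⟨hab, hac, hbc, habc⟩ := h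
  obtain ⟨χ, hχ⟩ := hcrit _ habc
  -- Otherwise `χ` would color all of `E`. Flipping the color of `a` repairs `{a, b, c}` and must
  -- spoil another member `f`. Then `f` contains `a`, and its other vertices have the color opposite
  -- to that of `b` and `c`.
  have hmono : ∀ p ∈ ({a, b, c} : Set α), ∀ q ∈ ({a, b, c} : Set α), χ p = χ q := by
    by_contra! hcon
    obtain ⟨p, hp, q, hq, hpq⟩ := hcon
    refine hcol ⟨χ, fun e he => ?_⟩
    by_cases hee : e = {a, b, c}
    · subst hee
      exact ⟨p, hp, q, hq, hpq⟩
    · exact hχ e ⟨he, hee⟩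
  have hb : χ b = χ a := hmono b (by simp) a (by simp)
  have hc : χ c = χ a := hmono c (by simp) a (by simp)
  have h1 : ¬ ∀ e ∈ E, ∃ p ∈ e, ∃ q ∈ e,
      Function.update χ a (!χ a) p ≠ Function.update χ a (!χ a) q := fun h => hcol ⟨_, h⟩
  push Not at h1
  obtain ⟨f, hf, hfm⟩ := h1
  have hfne : f ≠ {a, b, c} := by
    rintro rfl
    have := hfm a (by simp) b (by simp)
    simp [hab.symm, hb] at this
  obtain ⟨p, hp, q, hq, hpq⟩ := hχ f ⟨hf, hfne⟩
  have haf : a ∈ f := by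
    by_contra haf
    have h2 := hfm p hp q hq
    rw [Function.update_of_ne (by rintro rfl; exact haf hp),
      Function.update_of_ne (by rintro rfl; exact haf hq)] at h2
    exact hpq h2
  have hcolor : ∀ s ∈ f, s ≠ a → χ s = !χ a := by
    intro s hs hsa
    have h2 := hfm s hs a haf
    rwa [Function.update_of_ne hsa, Function.update_self] at h2
  obtain ⟨s, t, hst, hsa, hta, rfl⟩ : ∃ s t, s ≠ t ∧ s ≠ a ∧ t ≠ a ∧ f = {a, s, t} := by
    obtain ⟨x, y, z, hxy, hxz, hyz, rfl⟩ := Set.ncard_eq_three.mp (hE f hf)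
    rcases haf with rfl | rfl | rfl
    · exact ⟨y, z, hyz, hxy.symm, hxz.symm, rfl⟩
    · exact ⟨x, z, hxz, hxy, hyz.symm, Set.insert_comm _ _ _⟩
    · exact ⟨x, y, hxy, hxz, hyz, by rw [Set.insert_comm a, Set.pair_comm a]⟩
  have hs := hcolor s (by simp) hsa
  have ht := hcolor t (by simp) hta
  refine ⟨s, t, ⟨hsa.symm, hta.symm, hst, hf⟩, ?_, ?_, ?_, ?_⟩ <;> rintro rfl <;> simp_all

lemma containsK53_of_containsK5 {H : Hypergraph α} {E : Set (Set α)} (hE : E ⊆ E(H))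
    (h : ContainsK5 (tripleRel E)) : H.ContainsK53 := by
  classical
  obtain ⟨Q, hQ, hQ'⟩ := h
  have hmem : ∀ e ∈ E(completeUniformOn 3 (Q : Set α)), e ∈ E(H) := by
    rintro e ⟨he, he3⟩
    obtain ⟨x, y, z, hxy, hxz, hyz, rfl⟩ := Set.ncard_eq_three.mp he3
    exact hE (hQ' x (he (by simp)) y (he (by simp)) z (he (by simp)) hxy hxz hyz).2.2.2
  refine ⟨Q, by simpa using hQ, ?_, hmem⟩
  intro x hx
  have hx' : x ∈ Q := hx
  have h4 : (Q.erase x).card = 4 := by rw [Finset.card_erase_of_mem hx', hQ]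
  obtain ⟨y, hy, z, hz, hyz⟩ := Finset.one_lt_card.mp (by omega : 1 < (Q.erase x).card)
  rw [Finset.mem_erase] at hy hz
  have := (hQ' x hx' y hy.2 z hz.2 hy.1.symm hz.1.symm hyz).2.2.2
  exact H.subset_vertexSet_of_mem_edgeSet (hE this) (by simp)

/-- A finite 3-uniform linear-cycle-free hypergraph without a complete subhypergraph on five
vertices is 2-colorable. -/
theorem LinearCycleFree.twoColorable {H : Hypergraph α} (hV : V(H).Finite)
    (h3 : H.IsUniform 3) (hH : H.LinearCycleFree) (hK : ¬ H.ContainsK53) {E : Set (Set α)}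
    (hE : E ⊆ E(H)) : TwoColorable E := by
  classical
  have hEfin : E(H).Finite :=
    hV.finite_subsets.subset fun e he => H.subset_vertexSet_of_mem_edgeSet he
  induction hk : E.ncard using Nat.strong_induction_on generalizing E with
  | _ k ih =>
    subst hk
    by_contra hcol
    have hcrit : ∀ e ∈ E, TwoColorable (E \ {e}) := fun e he =>
      ih _ (Set.ncard_sdiff_singleton_lt_of_mem he (hEfin.subset hE))
        (Set.sdiff_subset.trans hE) rfl
    have hE3 : ∀ e ∈ E, e.ncard = 3 := fun e he => h3 e (hE he)
    obtain ⟨e, he⟩ : E.Nonempty := by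
      by_contra hne
      rw [Set.not_nonempty_iff_eq_empty] at hne
      subst hne
      exact hcol ⟨fun _ => true, by simp⟩
    obtain ⟨r, b, c, hrb, hrc, hbc, rfl⟩ := Set.ncard_eq_three.mp (hE3 e he)
    refine hK (containsK53_of_containsK5 hE (containsK5_of_isExtendableOffRoot
      (isLinearCycleFree_tripleRel hH hE) (W := hV.toFinset) (r := r) (b := b) (c := c)
      ?_ ?_ ⟨hrb, hrc, hbc, he⟩))
    · rintro x y z ⟨_, _, _, h⟩
      exact hV.mem_toFinset.mpr (H.subset_vertexSet_of_mem_edgeSet (hE h) (by simp))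
    · intro x y z h _
      exact exists_extension_of_critical hE3 hcol hcrit h

lemma bddAbove_independent_ncard {H : Hypergraph α} (hV : V(H).Finite) :
    BddAbove {m : ℕ | ∃ I : Set α, H.IsIndependent I ∧ I.ncard = m} := by
  refine ⟨V(H).ncard, ?_⟩
  rintro m ⟨I, hI, rfl⟩
  exact Set.ncard_le_ncard hI.1 hV

/-- The two color classes are independent and cover the vertices, so one of them has at least half
of them. -/
theorem LinearCycleFree.half_le_indepNum {H : Hypergraph α} (hV : V(H).Finite)
    (h3 : H.IsUniform 3) (hH : H.LinearCycleFree) (hK : ¬ H.ContainsK53) :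
    ⌈(V(H).ncard : ℚ) / 2⌉₊ ≤ H.indepNum := by
  obtain ⟨χ, hχ⟩ := hH.twoColorable hV h3 hK subset_rfl
  have hind : ∀ i, H.IsIndependent {x ∈ V(H) | χ x = i} := by
    refine fun i => ⟨fun x hx => hx.1, fun e he hsub => ?_⟩
    obtain ⟨a, ha, b, hb, hab⟩ := hχ e he
    exact hab ((hsub ha).2.trans (hsub hb).2.symm)
  have hle : ∀ i, {x ∈ V(H) | χ x = i}.ncard ≤ H.indepNum := fun i =>
    le_csSup (bddAbove_independent_ncard hV) ⟨_, hind i, rfl⟩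
  have hunion : V(H) = {x ∈ V(H) | χ x = true} ∪ {x ∈ V(H) | χ x = false} := by
    ext x
    cases h : χ x <;> simp [h]
  have hcard : V(H).ncard ≤ {x ∈ V(H) | χ x = true}.ncard + {x ∈ V(H) | χ x = false}.ncard := by
    conv_lhs => rw [hunion]
    exact Set.ncard_union_le _ _
  have h1 := hle true
  have h2 := hle false
  rw [Nat.ceil_le, div_le_iff₀ (by norm_num)]
  exact_mod_cast (by omega : V(H).ncard ≤ H.indepNum * 2)

end Hypergraph

/-! ### Sharpness of the bound -/

namespace Hypergraph

variable {α : Type*}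

section AddPair

variable {H : Hypergraph α} {a b : α}

lemma mem_addPair_of_mem_left {e : Set α} (ha : a ∉ V(H)) (he : e ∈ E(H.addPair a b))
    (hae : a ∈ e) : ∃ w ∈ V(H), e = {a, b, w} := by
  rcases he with he | he
  · exact absurd (H.subset_vertexSet_of_mem_edgeSet he hae) ha
  · exact he

lemma mem_addPair_of_mem_right {e : Set α} (hb : b ∉ V(H)) (he : e ∈ E(H.addPair a b))
    (hbe : b ∈ e) : ∃ w ∈ V(H), e = {a, b, w} := by
  rcases he with he | he
  · exact absurd (H.subset_vertexSet_of_mem_edgeSet he hbe) hb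
  · exact he

lemma mem_addPair_iff {e : Set α} (ha : a ∉ V(H)) (hb : b ∉ V(H)) (he : e ∈ E(H.addPair a b)) :
    a ∈ e ↔ b ∈ e := by
  constructor
  · intro h
    obtain ⟨w, _, rfl⟩ := mem_addPair_of_mem_left ha he h
    simp
  · intro h
    obtain ⟨w, _, rfl⟩ := mem_addPair_of_mem_right hb he h
    simp

lemma IsUniform.addPair (hH : H.IsUniform 3) (ha : a ∉ V(H)) (hb : b ∉ V(H)) (hab : a ≠ b) :
    (H.addPair a b).IsUniform 3 := by
  rintro e (he | ⟨w, hw, rfl⟩)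
  · exact hH e he
  · exact Set.ncard_eq_three.mpr ⟨a, b, w, hab, by rintro rfl; exact ha hw,
      by rintro rfl; exact hb hw, rfl⟩

/-- A K5 using one of `a`, `b` would have a hyperedge through it that avoids the other, so a K5 must
already lie in `H`. -/
lemma not_containsK53_addPair (hH : ¬ H.ContainsK53) (ha : a ∉ V(H)) (hb : b ∉ V(H))
    (hab : a ≠ b) : ¬ (H.addPair a b).ContainsK53 := by
  rintro ⟨S, hS, hSV, hSE⟩
  have hfin : S.Finite := Set.finite_of_ncard_ne_zero (by omega)
  have hcon : ∀ p q, (∀ e ∈ E(H.addPair a b), p ∈ e → q ∈ e) → p ∈ S → p = q := by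
    intro p q h hp
    by_contra hpq
    have h3 : 3 ≤ (S \ {p, q}).ncard := by
      have h1 := Set.ncard_le_ncard_sdiff_add_ncard S {p, q} (Set.toFinite _)
      have h2 := Set.ncard_pair hpq
      omega
    obtain ⟨s, t, hs, ht, hst⟩ := (Set.one_lt_ncard_iff (hfin.subset Set.sdiff_subset)).mp
      (by omega : 1 < (S \ {p, q}).ncard)
    simp only [Set.mem_sdiff, Set.mem_insert_iff, Set.mem_singleton_iff, not_or] at hs ht
    have hmem : ({p, s, t} : Set α) ∈ E(H.addPair a b) := by
      apply hSE
      refine ⟨?_, Set.ncard_eq_three.mpr ⟨p, s, t, fun h => hs.2.1 h.symm, fun h => ht.2.1 h.symm,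
        hst, rfl⟩⟩
      rintro x (rfl | rfl | rfl)
      · exact hp
      · exact hs.1
      · exact ht.1
    have := h _ hmem (by simp)
    simp only [Set.mem_insert_iff, Set.mem_singleton_iff] at this
    rcases this with h | h | h
    · exact hpq h.symm
    · exact hs.2.2 h.symm
    · exact ht.2.2 h.symm
  have haS : a ∉ S := fun h => hab (hcon a b (fun e he => (mem_addPair_iff ha hb he).1) h)
  have hbS : b ∉ S := fun h => hab (hcon b a (fun e he => (mem_addPair_iff ha hb he).2) h).symm
  refine hH ⟨S, hS, fun x hx => ?_, fun e he => ?_⟩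
  · rcases hSV hx with h | rfl | rfl
    · exact h
    · exact absurd hx haS
    · exact absurd hx hbS
  · rcases hSE he with h | ⟨w, _, rfl⟩
    · exact h
    · exact absurd (he.1 (by simp)) haS

/-- Hyperedges contain `a` and `b` together, so neither can be the single common vertex of two
hyperedges. A new hyperedge `{a, b, w}` then has only `w` as a linking vertex, while a linear cycle
needs two. -/
lemma LinearCycleFree.addPair (hH : H.LinearCycleFree) (ha : a ∉ V(H)) (hb : b ∉ V(H))
    (hab : a ≠ b) : (H.addPair a b).LinearCycleFree := by
  rintro ⟨k, v, h, hc⟩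
  have h3 := hc.three_le
  have key : ∀ i j, ∀ x, h i ∩ h j = {x} → x ≠ a ∧ x ≠ b := by
    intro i j x hx
    have hai := mem_addPair_iff ha hb (hc.edge_mem i)
    have haj := mem_addPair_iff ha hb (hc.edge_mem j)
    have hxm : x ∈ h i ∩ h j := by rw [hx]; rfl
    constructor
    · rintro rfl
      have : b ∈ h i ∩ h j := ⟨hai.1 hxm.1, haj.1 hxm.2⟩
      rw [hx] at this
      exact hab this.symm
    · rintro rfl
      have : a ∈ h i ∩ h j := ⟨hai.2 hxm.1, haj.2 hxm.2⟩
      rw [hx] at this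
      exact hab this
  have hprev : ∀ i, ∃ j, h j ∩ h i = {v i} := by
    intro i
    by_cases hi : (i : ℕ) = 0
    · exact ⟨⟨k - 1, by omega⟩, by
        rw [Set.inter_comm]; exact hc.inter_first_last i _ hi (by simp; omega)⟩
    · exact ⟨⟨i - 1, by omega⟩, hc.inter_succ _ i (by simp; omega)⟩
  have hnext : ∀ i, ∃ j, j ≠ i ∧ h i ∩ h j = {v j} := by
    intro i
    by_cases hi : (i : ℕ) + 1 = k
    · exact ⟨⟨0, by omega⟩, fun h => by have := congrArg Fin.val h; simp at this; omega, by
        rw [Set.inter_comm]; exact hc.inter_first_last _ i rfl hi⟩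
    · exact ⟨⟨i + 1, by omega⟩, by intro h; simp [Fin.ext_iff] at h, hc.inter_succ i _ rfl⟩
  have hmem : ∀ i, h i ∈ E(H) := by
    intro i
    rcases hc.edge_mem i with he | ⟨w, hw, he⟩
    · exact he
    · exfalso
      obtain ⟨j, hj⟩ := hprev i
      obtain ⟨l, hl, hil⟩ := hnext i
      have h1 := key _ _ _ hj
      have h2 := key _ _ _ hil
      have h1' : v i ∈ h i := (by rw [hj]; rfl : v i ∈ h j ∩ h i).2
      have h2' : v l ∈ h i := (by rw [hil]; rfl : v l ∈ h i ∩ h l).1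
      rw [he] at h1' h2'
      simp only [Set.mem_insert_iff, Set.mem_singleton_iff, h1, h2, false_or] at h1' h2'
      exact hl (hc.vertex_injective (h2'.trans h1'.symm))
  refine hH ⟨k, v, h, ⟨h3, fun i => ?_, hmem, hc.vertex_injective, hc.edge_injective,
    hc.inter_succ, hc.inter_first_last, hc.disjoint⟩⟩
  obtain ⟨j, hj⟩ := hprev i
  exact H.subset_vertexSet_of_mem_edgeSet (hmem i) (by rw [hj]; rfl : v i ∈ h j ∩ h i).2

lemma ncard_independent_addPair_le {m : ℕ} (hV : V(H).Finite) (hm : 1 ≤ m)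
    (hH : ∀ I, H.IsIndependent I → I.ncard ≤ m) {I : Set α}
    (hI : (H.addPair a b).IsIndependent I) : I.ncard ≤ m + 1 := by
  have hind : H.IsIndependent (I ∩ V(H)) :=
    ⟨Set.inter_subset_right, fun e he hsub => hI.2 e (.inl he) (hsub.trans Set.inter_subset_left)⟩
  have hsub : I ⊆ (I ∩ V(H)) ∪ (I ∩ {a, b}) := by
    intro x hx
    rcases hI.1 hx with h | h
    · exact .inl ⟨hx, h⟩
    · exact .inr ⟨hx, h⟩
  have hle := (Set.ncard_le_ncard hsub ((hV.subset Set.inter_subset_right).union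
    ((Set.toFinite {a, b}).subset Set.inter_subset_right))).trans (Set.ncard_union_le _ _)
  have h1 := hH _ hind
  have h2 : (I ∩ {a, b}).ncard ≤ 2 :=
    (Set.ncard_le_ncard Set.inter_subset_right (Set.toFinite _)).trans (by
      simpa using Set.ncard_insert_le a {b})
  by_cases hab : a ∈ I ∧ b ∈ I
  -- With `a` and `b` both in `I`, any further vertex would complete a hyperedge; so `I` has at most
  -- two elements, and `1 ≤ m` suffices.
  · have : I ∩ V(H) = ∅ := by
      by_contra hne
      obtain ⟨w, hw, hwV⟩ := Set.nonempty_iff_ne_empty.mpr hne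
      refine hI.2 _ (.inr ⟨w, hwV, rfl⟩) ?_
      rintro x (rfl | rfl | rfl)
      · exact hab.1
      · exact hab.2
      · exact hw
    rw [this, Set.ncard_empty] at hle
    omega
  · have : (I ∩ {a, b}).ncard ≤ 1 := by
      rw [Set.ncard_le_one ((Set.toFinite {a, b}).subset Set.inter_subset_right)]
      rintro x ⟨hx, rfl | rfl⟩ y ⟨hy, rfl | rfl⟩
      · rfl
      · exact absurd ⟨hx, hy⟩ hab
      · exact absurd ⟨hy, hx⟩ hab
      · rfl
    omega

end AddPair

section Complete

lemma isUniform_completeUniformOn (r : ℕ) (S : Set α) : (completeUniformOn r S).IsUniform r :=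
  fun _ he => he.2

lemma not_containsK53_of_ncard_lt {H : Hypergraph α} (hV : V(H).Finite) (h : V(H).ncard < 5) :
    ¬ H.ContainsK53 := by
  rintro ⟨S, hS, hSV, _⟩
  have := Set.ncard_le_ncard (show S ⊆ V(H) from hSV) hV
  omega

/-- Two triples that share exactly one vertex need five vertices. -/
lemma linearCycleFree_of_ncard_le_four {H : Hypergraph α} (hV : V(H).Finite)
    (h3 : H.IsUniform 3) (h : V(H).ncard ≤ 4) : H.LinearCycleFree := by
  rintro ⟨k, v, e, hc⟩
  have hk := hc.three_le
  have h0 := hc.inter_succ ⟨0, by omega⟩ ⟨1, by omega⟩ rfl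
  have he0 := hc.edge_mem ⟨0, by omega⟩
  have he1 := hc.edge_mem ⟨1, by omega⟩
  have hs0 := H.subset_vertexSet_of_mem_edgeSet he0
  have hs1 := H.subset_vertexSet_of_mem_edgeSet he1
  have h1 := Set.ncard_union_add_ncard_inter (e ⟨0, by omega⟩) (e ⟨1, by omega⟩)
    (hV.subset hs0) (hV.subset hs1)
  rw [h0, Set.ncard_singleton, h3 _ he0, h3 _ he1] at h1
  have h2 := Set.ncard_le_ncard (Set.union_subset hs0 hs1) hV
  omega

lemma ncard_independent_completeUniformOn_le {S I : Set α}
    (hI : (completeUniformOn 3 S).IsIndependent I) : I.ncard ≤ 2 := by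
  by_contra! h
  obtain ⟨J, hJ, hJ3⟩ := Set.exists_subset_card_eq (by omega : 3 ≤ I.ncard)
  exact hI.2 J ⟨hJ.trans hI.1, hJ3⟩ hJ

end Complete

lemma vertexSet_iteratedPair (n : ℕ) : V(iteratedPair n) = Set.Icc 1 n := by
  induction n using Nat.strong_induction_on with
  | _ n ih =>
    match n with
    | 0 => ext x; simp [iteratedPair, trivialOn]
    | 1 => ext x; simp [iteratedPair, trivialOn]
    | 2 => ext x; simp [iteratedPair, trivialOn]; omega
    | 3 => ext x; simp [iteratedPair, completeUniformOn]; omega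
    | 4 => ext x; simp [iteratedPair, completeUniformOn]; omega
    | (i + 3) + 2 =>
      ext x
      simp only [iteratedPair, addPair, ih (i + 3) (by omega), Set.mem_union, Set.mem_Icc,
        Set.mem_insert_iff, Set.mem_singleton_iff]
      omega

lemma iteratedPair_properties (n : ℕ) (hn : 3 ≤ n) :
    (iteratedPair n).IsUniform 3 ∧ (iteratedPair n).LinearCycleFree ∧
      ¬ (iteratedPair n).ContainsK53 ∧
      ∀ I, (iteratedPair n).IsIndependent I → I.ncard ≤ (n + 1) / 2 := by
  induction n using Nat.strong_induction_on with
  | _ n ih =>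
    have hV : ∀ n, V(iteratedPair n).Finite := fun n => by
      rw [vertexSet_iteratedPair]; exact Set.finite_Icc 1 n
    have hcard : ∀ n, V(iteratedPair n).ncard = n := fun n => by
      rw [vertexSet_iteratedPair, ← Finset.coe_Icc, Set.ncard_coe_finset]; simp
    match n with
    | 0 | 1 | 2 => omega
    | 3 =>
      have hu : (iteratedPair 3).IsUniform 3 := isUniform_completeUniformOn 3 _
      exact ⟨hu, linearCycleFree_of_ncard_le_four (hV 3) hu (by simp [hcard]),
        not_containsK53_of_ncard_lt (hV 3) (by simp [hcard]),
        fun I hI => ncard_independent_completeUniformOn_le hI⟩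
    | 4 =>
      have hu : (iteratedPair 4).IsUniform 3 := isUniform_completeUniformOn 3 _
      exact ⟨hu, linearCycleFree_of_ncard_le_four (hV 4) hu (by simp [hcard]),
        not_containsK53_of_ncard_lt (hV 4) (by simp [hcard]),
        fun I hI => ncard_independent_completeUniformOn_le hI⟩
    | (i + 3) + 2 =>
      obtain ⟨h1, h2, h3, h4⟩ := ih (i + 3) (by omega) (by omega)
      have ha : (i + 3) + 1 ∉ V(iteratedPair (i + 3)) := by
        rw [vertexSet_iteratedPair]; simp
      have hb : (i + 3) + 2 ∉ V(iteratedPair (i + 3)) := by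
        rw [vertexSet_iteratedPair]; simp
      refine ⟨h1.addPair ha hb (by omega), h2.addPair ha hb (by omega),
        not_containsK53_addPair h3 ha hb (by omega), fun I hI => ?_⟩
      have := ncard_independent_addPair_le (hV _) (by omega) h4 hI
      omega

end Hypergraph

theorem mainTheorem2 :
    (∀ (α : Type*) (H : Hypergraph α) (n : ℕ),
      V(H).Finite → V(H).ncard = n →
      H.IsUniform 3 → H.LinearCycleFree → ¬ H.ContainsK53 →
        ⌈(n : ℚ) / 2⌉₊ ≤ H.indepNum) ∧
    (∀ n : ℕ, 3 ≤ n →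
      V(Hypergraph.iteratedPair n).Finite ∧ V(Hypergraph.iteratedPair n).ncard = n ∧
      (Hypergraph.iteratedPair n).IsUniform 3 ∧
      (Hypergraph.iteratedPair n).LinearCycleFree ∧
      ¬ (Hypergraph.iteratedPair n).ContainsK53 ∧
      (Hypergraph.iteratedPair n).indepNum = ⌈(n : ℚ) / 2⌉₊) := by
  refine ⟨?_, ?_⟩
  · rintro α H n hV rfl h3 hH hK
    exact hH.half_le_indepNum hV h3 hK
  · intro n hn
    obtain ⟨h1, h2, h3, h4⟩ := Hypergraph.iteratedPair_properties n hn
    have hV : V(Hypergraph.iteratedPair n).Finite := by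
      rw [Hypergraph.vertexSet_iteratedPair]; exact Set.finite_Icc 1 n
    have hcard : V(Hypergraph.iteratedPair n).ncard = n := by
      rw [Hypergraph.vertexSet_iteratedPair, ← Finset.coe_Icc, Set.ncard_coe_finset]; simp
    refine ⟨hV, hcard, h1, h2, h3, le_antisymm ?_ ?_⟩
    · refine csSup_le' ?_
      rintro m ⟨I, hI, rfl⟩
      have h5 : (n : ℚ) / 2 ≤ ⌈(n : ℚ) / 2⌉₊ := Nat.le_ceil _
      have h6 : n ≤ ⌈(n : ℚ) / 2⌉₊ * 2 := by
        rw [div_le_iff₀ (by norm_num)] at h5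
        exact_mod_cast h5
      have := h4 I hI
      omega
    -- The lower bound is the general bound applied to `iteratedPair n` itself.
    · have := h2.half_le_indepNum hV h1 h3
      rwa [hcard] at this
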